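/- \textbf{Setting.} An extended (oblique) bi-factor model with $J$ variables and $G$ group factors is given by a partition of $\{1,\dots,J\}$ into groups $\mathcal B_1,\dots,\mathcal B_G$ and real matrices $\Lambda=(\lambda_{jk})\in\mathbb R^{J\times(G+1)}$, $\Phi=(\phi_{kk'})\in\mathbb R^{(G+1)\times(G+1)}$, $\Psi\in\mathbb R^{J\times J}$ such that $\lambda_{j,g+1}=0$ whenever $j\notin\mathcal B_g$; $\Phi$ is a strictly positive definite correlation matrix with $\phi_{1k}=0$ for all $k\ne1$; and $\Psi$ is diagonal. The covariance matrix is $\Lambda\Phi\Lambda^\top+\Psi$. Write $\mathcal Q_g=\{j\in\mathcal B_g:\lambda_{j,g+1}\neq0\}$ and let $H$ be the set of all $g$ for which the submatrix $\Lambda[\mathcal B_g,\{1,1+g\}]$ has rank $2$. \textbf{Condition 4.} $|H|\ge2$; $|\mathcal Q_g|\ge2$ for $g=1,\dots,G$; and $|\mathcal Q_g|\ge3$ for every $g$ such that $\phi_{1+g,1+g'}=0$ for all $g'\in\{1,\dots,G\}$, $g'\ne g$. \textbf{Condition 5.} $|H|\ge3$, and there are three different groups $g_1,g_2,g_3\in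 H$ such that $|\mathcal Q_{g_i}|\ge3$ for $i=1,2,3$ and any two different rows of $\Lambda[\mathcal B_{g_1},\{1,1+g_1\}]$ are linearly independent. \textbf{Theorem 2.} Let $J=24$, $G=7$. Let $\Lambda^*,\Phi^*,\Psi^*$ be parameters of an extended bi-factor model whose groups are $\mathcal B^*_1=\{1,2,3,4,7\}$, $\mathcal B^*_2=\{19,20\}$, $\mathcal B^*_3=\{21,22,23,24\}$, $\mathcal B^*_4=\{6,9,10,11,12\}$, $\mathcal B^*_5=\{13,14,15,16\}$, $\mathcal B^*_6=\{5,8\}$, $\mathcal B^*_7=\{17,18\}$ (the structure estimated in the extraversion data), where $\lambda^*_{j,g+1}\ne0$ if and only if $j\in\mathcal B^*_g$, and suppose that they satisfy Conditions 4 and 5. Let $\Lambda,\Phi,\Psi$ be any parameters of an extended bi-factor model with $24$ variables and $7$ group factors, with an arbitrary partition into groups $\mathcal B_1,\dots,\mathcal B_7$, which satisfy Condition 4 and $$\Lambda^*\Phi^*(\Lambda^*)^\top+\Psi^*=\Lambda\Phi\Lambda^\top+\Psi .$$ Then there exist a diagonal matrix $D$ with diagonal entries in $\{1,-1\}$ and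 an $8\times8$ permutation matrix $P$ with $P_{11}=1$ such that $\Lambda=\Lambda^*PD$, $\Phi=DP^\top\Phi^*PD$ and $\Psi^*=\Psi$. -/

import Mathlib

/-- The loading matrix `Λ`, the factor correlation matrix `Φ` and the unique-variance matrix `Ψ`
are parameters of an extended bi-factor model with `J` variables and `G` group factors whose
groups are the fibres `B_g = {j | b j = g}` of `b`.  Column `0` is the general factor and column
`g.succ` is the group factor `g`.  Here `Φ` is a strictly positive definite correlation matrix
in which the general factor is uncorrelated with the group factors, and `Ψ` is diagonal. -/
structure IsBifactor {J G : ℕ} (b : Fin J → Fin G) (Λ : Matrix (Fin J) (Fin (G + 1)) ℝ)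
    (Φ : Matrix (Fin (G + 1)) (Fin (G + 1)) ℝ) (Ψ : Matrix (Fin J) (Fin J) ℝ) : Prop where
  loading_eq_zero : ∀ j g, b j ≠ g → Λ j g.succ = 0
  posDef : Φ.PosDef
  diag_eq_one : ∀ k, Φ k k = 1
  general_uncorrelated : ∀ k, k ≠ 0 → Φ 0 k = 0
  isDiag : Ψ.IsDiag

/-- The block `Λ[B_g, {1, 1 + g}]`: rows in the group `g`, and the columns of the general factor
and of the group factor `g`. -/
def groupBlock {J G : ℕ} (b : Fin J → Fin G) (Λ : Matrix (Fin J) (Fin (G + 1)) ℝ) (g : Fin G) :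
    Matrix {j // b j = g} (Fin 2) ℝ :=
  Matrix.of fun j => ![Λ j 0, Λ j g.succ]

/-- `Q_g`: the variables of group `g` with a nonzero loading on the group factor `g`. -/
def groupSupport {J G : ℕ} (b : Fin J → Fin G) (Λ : Matrix (Fin J) (Fin (G + 1)) ℝ)
    (g : Fin G) : Set (Fin J) :=
  {j | b j = g ∧ Λ j g.succ ≠ 0}

/-- `H`: the groups `g` for which `Λ[B_g, {1, 1 + g}]` has column rank `2`. -/
def fullRankGroups {J G : ℕ} (b : Fin J → Fin G) (Λ : Matrix (Fin J) (Fin (G + 1)) ℝ) :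
    Set (Fin G) :=
  {g | (groupBlock b Λ g).rank = 2}

/-- The necessary condition for identifiability under a known bi-factor structure. -/
structure NecessaryCondition {J G : ℕ} (b : Fin J → Fin G)
    (Λ : Matrix (Fin J) (Fin (G + 1)) ℝ) (Φ : Matrix (Fin (G + 1)) (Fin (G + 1)) ℝ) : Prop where
  two_le_fullRank : 2 ≤ (fullRankGroups b Λ).ncard
  two_le_support : ∀ g, 2 ≤ (groupSupport b Λ g).ncard
  three_le_support : ∀ g, (∀ g', g' ≠ g → Φ g.succ g'.succ = 0) →
    3 ≤ (groupSupport b Λ g).ncard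

/-- The additional condition on the true loading matrix: three different groups of rank `2`, each
with at least three nonzero group loadings, such that in the first of them any two different rows
of the block `Λ[B_g, {1, 1 + g}]` are linearly independent. -/
def SeparationCondition {J G : ℕ} (b : Fin J → Fin G)
    (Λ : Matrix (Fin J) (Fin (G + 1)) ℝ) : Prop :=
  3 ≤ (fullRankGroups b Λ).ncard ∧
  ∃ g₁ ∈ fullRankGroups b Λ, ∃ g₂ ∈ fullRankGroups b Λ, ∃ g₃ ∈ fullRankGroups b Λ,
    g₁ ≠ g₂ ∧ g₁ ≠ g₃ ∧ g₂ ≠ g₃ ∧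
    3 ≤ (groupSupport b Λ g₁).ncard ∧
    3 ≤ (groupSupport b Λ g₂).ncard ∧
    3 ≤ (groupSupport b Λ g₃).ncard ∧
    ∀ i j : {j // b j = g₁}, i ≠ j →
      LinearIndependent ℝ ![groupBlock b Λ g₁ i, groupBlock b Λ g₁ j]

/-- The group (numbered from `0`) of each of the 24 extraversion items in the estimated loading
matrix: the groups of items are `{1, 2, 3, 4, 7}`, `{19, 20}`, `{21, 22, 23, 24}`,
`{6, 9, 10, 11, 12}`, `{13, 14, 15, 16}`, `{5, 8}` and `{17, 18}`. -/
def extraversionGroup : Fin 24 → Fin 7 :=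
  ![0, 0, 0, 0, 5, 3, 0, 5, 3, 3, 3, 3, 4, 4, 4, 4, 6, 6, 1, 1, 2, 2, 2, 2]

/-- `Λ` has the bi-factor structure of the estimated extraversion loading matrix: on the group
factors, its nonzero loadings are at exactly the same places. -/
def FollowsExtraversionStructure (Λ : Matrix (Fin 24) (Fin (7 + 1)) ℝ) : Prop :=
  ∀ j g, Λ j g.succ ≠ 0 ↔ extraversionGroup j = g

/-- Diagonal matrices with diagonal entries `1` or `-1`. -/
def signFlipMatrices (n : ℕ) : Set (Matrix (Fin n) (Fin n) ℝ) :=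
  {D | ∃ d : Fin n → ℝ, (∀ i, d i = 1 ∨ d i = -1) ∧ D = Matrix.diagonal d}

/-- Permutation matrices that fix the first coordinate (the general factor). -/
def factorPermutationMatrices (G : ℕ) : Set (Matrix (Fin (G + 1)) (Fin (G + 1)) ℝ) :=
  {P | ∃ σ : Equiv.Perm (Fin (G + 1)), P = σ.permMatrix ℝ ∧ P 0 0 = 1}

/-! The covariance matrix shows the common part `ΛΦΛᵀ` only off the diagonal; the crux is to recover
its diagonal, the communalities. Once the whole common part is known, the two factorizations differ
by a matrix `T` of factor coordinates (`exists_factor_rotation`). Two independent rows of one true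
group that both miss a group of the second model force zeros in `T`. With three pairwise independent
rows in one group and two independent rows in another, `T` becomes a signed permutation
(`bifactor_unique`).

A communality is a function of off-diagonal entries when two disjoint nonsingular sets of eight rows
avoid the variable (`communality_eq`). Such a set takes one item per group and one extra item from a
group of rank two. The three groups of the separation condition are large, that is, have at least
three items. An item of a large group lies outside two of them, and enough items remain for both
sets. So the large groups are identified, and covariances with the first of the three groups
determine the general loadings of the six items in two-item groups.

The second model has three groups left, each needing two nonzero loadings, and only these six items
can fill them, so each has a mate among the six (`exists_groupmate`). A mate from another true group
would make two true group factors perfectly correlated. Hence the pairs agree, and a nonzero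
correlation with another group fixes the squared group loadings. All communalities now agree, and
uniqueness applies to the full common part. -/

/-! ### Factor rotations and linear algebra -/

open Matrix in
/-- Two factorizations of one matrix, of which the first has full column rank, differ by a
change of factor coordinates that carries one factor correlation matrix to the other. -/
theorem exists_factor_rotation {ι m n : Type*} [Fintype ι] [DecidableEq ι] [Fintype m]
    [DecidableEq m] [Fintype n] {A : Matrix ι m ℝ} {R : Matrix m m ℝ} {B : Matrix ι n ℝ}
    {Q : Matrix n n ℝ} (hA : Function.Injective A.mulVec) (hQ : Q.PosDef)
    (hL : A * R * Aᵀ = B * Q * Bᵀ) :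
    ∃ T : Matrix m n ℝ, B = A * T ∧ T * Q * Tᵀ = R := by
  obtain ⟨N, hN⟩ : ∃ N : Matrix m ι ℝ, N * A = 1 := by
    obtain ⟨f, hf⟩ := LinearMap.exists_leftInverse_of_injective (toLin' A)
      (LinearMap.ker_eq_bot.2 hA)
    have := LinearMap.toMatrix'_comp f (toLin' A)
    rw [hf, LinearMap.toMatrix'_id, LinearMap.toMatrix'_toLin'] at this
    exact ⟨LinearMap.toMatrix' f, this.symm⟩
  have hN' : Aᵀ * Nᵀ = 1 := by rw [← transpose_mul, hN, transpose_one]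
  -- `A * N` fixes the columns of `A`, so the residual `E` of `B` satisfies `E * Q * Eᵀ = 0`, and
  -- positive definiteness kills each of its rows.
  refine ⟨N * B, ?_, ?_⟩
  · set E := B - A * (N * B) with hE
    have hE' : E = (1 - A * N) * B := by rw [hE, Matrix.sub_mul, Matrix.one_mul, Matrix.mul_assoc]
    have h0 : (1 - A * N) * A = 0 := by
      rw [Matrix.sub_mul, Matrix.one_mul, Matrix.mul_assoc, hN, Matrix.mul_one, sub_self]
    have hEQ : E * Q * Eᵀ = 0 := by
      rw [hE', transpose_mul]
      calc (1 - A * N) * B * Q * (Bᵀ * (1 - A * N)ᵀ)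
          = (1 - A * N) * (B * Q * Bᵀ) * (1 - A * N)ᵀ := by simp only [Matrix.mul_assoc]
        _ = ((1 - A * N) * A) * R * Aᵀ * (1 - A * N)ᵀ := by
            rw [← hL]; simp only [Matrix.mul_assoc]
        _ = 0 := by rw [h0]; simp
    have hE0 : E = 0 := by
      ext i k
      by_contra hne
      have hr : E i ≠ 0 := fun h => hne (congrFun h k)
      have hpos := hQ.dotProduct_mulVec_pos hr
      have hi : (E * Q * Eᵀ) i i = star (E i) ⬝ᵥ (Q *ᵥ E i) := by
        rw [Matrix.mul_assoc, mul_apply']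
        rfl
      rw [← hi, hEQ] at hpos
      exact lt_irrefl _ hpos
    exact sub_eq_zero.1 hE0
  · calc N * B * Q * (N * B)ᵀ = N * (B * Q * Bᵀ) * Nᵀ := by
          rw [transpose_mul]; simp only [Matrix.mul_assoc]
      _ = (N * A) * R * (Aᵀ * Nᵀ) := by rw [← hL]; simp only [Matrix.mul_assoc]
      _ = R := by rw [hN, hN']; simp

/-- Different factors with a positive definite correlation matrix are not perfectly correlated. -/
theorem Matrix.PosDef.sq_ne_one {m : Type*} [Fintype m] {R : Matrix m m ℝ} (hR : R.PosDef)
    (hd : ∀ k, R k k = 1) {k l : m} (hkl : k ≠ l) : R k l ^ 2 ≠ 1 := by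
  intro h
  have hinj : Function.Injective ![k, l] := by
    intro x y
    fin_cases x <;> fin_cases y <;> simp [hkl, hkl.symm]
  have hdet := (hR.submatrix hinj).det_pos
  have hsym : R l k = R k l := by simpa using hR.isHermitian.apply k l
  rw [Matrix.det_fin_two] at hdet
  simp [hd, hsym] at hdet
  nlinarith

/-- Three linearly independent rows do not vanish at all but two coordinates. -/
theorem not_linearIndependent_of_two_coordinates {n : Type*} [DecidableEq n]
    {v : Fin 3 → n → ℝ} (hv : LinearIndependent ℝ v) (k l : n)
    (h : ∀ x m, m ≠ k → m ≠ l → v x m = 0) : False := by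
  let f : (Fin 2 → ℝ) →ₗ[ℝ] n → ℝ :=
    { toFun := fun c m => if m = k then c 0 else if m = l then c 1 else 0
      map_add' := fun c d => by ext m; simp only [Pi.add_apply]; split_ifs <;> simp
      map_smul' := fun r c => by ext m; simp only [Pi.smul_apply]; split_ifs <;> simp }
  have hf : f ∘ (fun x => ![v x k, v x l]) = v := by
    funext x m
    simp only [f, Function.comp, LinearMap.coe_mk, AddHom.coe_mk]
    split_ifs with h1 h2
    · simp [h1]
    · simp [h2]
    · exact (h x m h1 h2).symm
  have hli : LinearIndependent ℝ (fun x => ![v x k, v x l]) :=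
    LinearIndependent.of_comp f (by rw [hf]; exact hv)
  simpa using hli.fintype_card_le_finrank

/-- A pair of linear equations with nonzero determinant has only the zero solution. -/
theorem eq_zero_of_det_ne_zero {p q r s x y : ℝ} (hd : p * s ≠ r * q) (h₁ : p * x + q * y = 0)
    (h₂ : r * x + s * y = 0) : x = 0 ∧ y = 0 := by
  have hd' : p * s - r * q ≠ 0 := sub_ne_zero.2 hd
  constructor
  · exact (mul_eq_zero.1 (show (p * s - r * q) * x = 0 by linear_combination s * h₁ - q * h₂)
      ).resolve_left hd'
  · exact (mul_eq_zero.1 (show (p * s - r * q) * y = 0 by linear_combination p * h₂ - r * h₁)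
      ).resolve_left hd'

/-! ### Uniqueness when the whole common part is known -/

open Matrix in
/-- Over a positive definite correlation matrix, the common parts of two bi-factor models agree
only if the models agree up to the signs and the order of the group factors, provided that one
group has three pairwise independent rows and another group has two independent rows.  The
general factor is `none`. -/
theorem bifactor_unique {ι γ κ : Type*} [Fintype ι] [DecidableEq ι] [Fintype γ] [DecidableEq γ]
    [Fintype κ] [DecidableEq κ] {g : ι → γ} {α μ : ι → ℝ} {R : Matrix (Option γ) (Option γ) ℝ}
    {b : ι → κ} {a u : ι → ℝ} {Q : Matrix (Option κ) (Option κ) ℝ}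
    (hg : Function.Surjective g) (hμ : ∀ i, μ i ≠ 0)
    (hR : R.PosDef) (hRd : ∀ k, R k k = 1) (hR0 : ∀ k, R none (some k) = 0)
    (hQ : Q.PosDef) (hQd : ∀ k, Q k k = 1) (hQ0 : ∀ k, Q none (some k) = 0)
    (hL : ∀ i j, α i * α j + μ i * μ j * R (some (g i)) (some (g j)) =
      a i * a j + u i * u j * Q (some (b i)) (some (b j)))
    {i₁ i₂ i₃ j₁ j₂ : ι} (hi₂ : g i₁ = g i₂) (hi₃ : g i₁ = g i₃) (hj : g j₁ = g j₂)
    (hij : g i₁ ≠ g j₁)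
    (h₁₂ : α i₁ * μ i₂ ≠ α i₂ * μ i₁) (h₁₃ : α i₁ * μ i₃ ≠ α i₃ * μ i₁)
    (h₂₃ : α i₂ * μ i₃ ≠ α i₃ * μ i₂) (hj₁₂ : α j₁ * μ j₂ ≠ α j₂ * μ j₁) :
    ∃ (c : ℝ) (d : γ → ℝ) (p : γ → κ), c ^ 2 = 1 ∧ (∀ k, d k ^ 2 = 1) ∧ Function.Injective p ∧
      (∀ i, b i = p (g i)) ∧ (∀ i, a i = c * α i) ∧ (∀ i, u i = d (g i) * μ i) ∧
      ∀ k l, R (some k) (some l) = d k * d l * Q (some (p k)) (some (p l)) := by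
  let A : Matrix ι (Option γ) ℝ := of fun i k => k.elim (α i) fun k => if g i = k then μ i else 0
  let B : Matrix ι (Option κ) ℝ := of fun i k => k.elim (a i) fun k => if b i = k then u i else 0
  have hRs : ∀ k, R (some k) none = 0 := fun k => by
    have := hR.isHermitian.apply (some k) none; simpa [hR0] using this.symm
  have hQs : ∀ k, Q (some k) none = 0 := fun k => by
    have := hQ.isHermitian.apply (some k) none; simpa [hQ0] using this.symm
  have hAB : A * R * Aᵀ = B * Q * Bᵀ := by
    ext i j
    simp only [mul_apply, transpose_apply, Fintype.sum_option, A, B, of_apply, Option.elim,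
      hRs, hR0, hQs, hQ0, hRd, hQd, ite_mul, mul_ite, mul_zero, zero_mul, add_zero, zero_add,
      mul_one, Finset.sum_ite_eq, Finset.mem_univ, if_true]
    linear_combination hL i j
  have hA : Function.Injective A.mulVec := by
    have hA' : ∀ x i, (A *ᵥ x) i = α i * x none + μ i * x (some (g i)) := fun x i => by
      simp [mulVec, dotProduct, Fintype.sum_option, A]
    rw [← coe_mulVecLin, ← LinearMap.ker_eq_bot, LinearMap.ker_eq_bot']
    intro x hx
    have hx' : ∀ i, α i * x none + μ i * x (some (g i)) = 0 := fun i => by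
      rw [← hA']; exact congrFun hx i
    have h0 := (eq_zero_of_det_ne_zero h₁₂ (hx' i₁) (by rw [hi₂]; exact hx' i₂)).1
    funext k
    cases k with
    | none => exact h0
    | some k =>
      obtain ⟨i, rfl⟩ := hg k
      have := hx' i
      rw [h0, mul_zero, zero_add] at this
      exact (mul_eq_zero.1 this).resolve_left (hμ i)
  obtain ⟨T, hT, hTQ⟩ := exists_factor_rotation hA hQ hAB
  have hrow0 : ∀ i, a i = α i * T none none + μ i * T (some (g i)) none := fun i => by
    have := congrFun (congrFun hT i) none
    simpa [mul_apply, Fintype.sum_option, A, B] using this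
  have hrow : ∀ i k, (if b i = k then u i else 0) =
      α i * T none (some k) + μ i * T (some (g i)) (some k) := fun i k => by
    have := congrFun (congrFun hT i) (some k)
    simpa [mul_apply, Fintype.sum_option, A, B] using this
  have hrow' : ∀ i k, b i ≠ k → α i * T none (some k) + μ i * T (some (g i)) (some k) = 0 :=
    fun i k h => by rw [← hrow, if_neg h]
  have hpair : ∀ i j k, g i = g j → α i * μ j ≠ α j * μ i → b i ≠ k → b j ≠ k →
      T none (some k) = 0 ∧ T (some (g i)) (some k) = 0 := fun i j k hgij hd hi hj =>
    eq_zero_of_det_ne_zero hd (hrow' i k hi) (by rw [hgij]; exact hrow' j k hj)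
  have hTli : LinearIndependent ℝ T.row := by
    rw [← vecMul_injective_iff]
    intro x y hxy
    have hxy' : x ᵥ* T = y ᵥ* T := hxy
    refine vecMul_injective_of_isUnit hR.isUnit ?_
    change x ᵥ* R = y ᵥ* R
    simp only [← hTQ, ← vecMul_vecMul, hxy']
  have hT0 : ∀ k, T none (some k) = 0 := by
    -- Only column `h` remains. If an item from the group of `j₁` has second group `h`, then three
    -- independent rows of `T` are supported on the two coordinates `none` and `h`, which is
    -- impossible.
    have key : ∀ h, (∀ k, k ≠ h → T none (some k) = 0 ∧ T (some (g i₁)) (some k) = 0) →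
        ∀ k, T none (some k) = 0 := by
      intro h hh k
      by_cases hk : k = h
      swap
      · exact (hh k hk).1
      subst hk
      by_cases hb : b j₁ ≠ k ∧ b j₂ ≠ k
      · exact (hpair j₁ j₂ k hj hj₁₂ hb.1 hb.2).1
      obtain ⟨j, hjg, hjb⟩ : ∃ j, g j = g j₁ ∧ b j = k := by
        by_cases h1 : b j₁ = k
        · exact ⟨j₁, rfl, h1⟩
        · exact ⟨j₂, hj.symm, by tauto⟩
      exfalso
      refine not_linearIndependent_of_two_coordinates
        (hTli.comp ![none, some (g i₁), some (g j₁)] ?_) none (some k) ?_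
      · intro x y
        fin_cases x <;> fin_cases y <;> simp [hij, hij.symm]
      · intro x m hm hm'
        cases m with
        | none => exact absurd rfl hm
        | some m =>
          have hmk : m ≠ k := fun h => hm' (by rw [h])
          have h3 := hrow' j m (by rw [hjb]; exact hmk.symm)
          rw [(hh m hmk).1, mul_zero, zero_add, hjg] at h3
          fin_cases x
          · exact (hh m hmk).1
          · exact (hh m hmk).2
          · exact (mul_eq_zero.1 h3).resolve_left (hμ j)
    by_cases e₁₂ : b i₁ = b i₂
    · exact key (b i₁) fun k hk => hpair i₁ i₂ k hi₂ h₁₂ hk.symm (by rw [← e₁₂]; exact hk.symm)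
    by_cases e₁₃ : b i₁ = b i₃
    · exact key (b i₁) fun k hk => hpair i₁ i₃ k hi₃ h₁₃ hk.symm (by rw [← e₁₃]; exact hk.symm)
    by_cases e₂₃ : b i₂ = b i₃
    · refine key (b i₂) fun k hk => ?_
      rw [hi₂]
      exact hpair i₂ i₃ k (hi₂.symm.trans hi₃) h₂₃ hk.symm (by rw [← e₂₃]; exact hk.symm)
    -- The three items now have different second groups, so for any `k` two of them miss `k`.
    intro k
    by_cases e₁ : b i₁ = k
    · exact (hpair i₂ i₃ k (hi₂.symm.trans hi₃) h₂₃ (by rw [← e₁]; exact Ne.symm e₁₂)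
        (by rw [← e₁]; exact Ne.symm e₁₃)).1
    by_cases e₂ : b i₂ = k
    · exact (hpair i₁ i₃ k hi₃ h₁₃ e₁ (by rw [← e₂]; exact Ne.symm e₂₃)).1
    exact (hpair i₁ i₂ k hi₂ h₁₂ e₁ e₂).1
  have hc : T none none ^ 2 = 1 := by
    have := congrFun (congrFun hTQ none) none
    simp [mul_apply, Fintype.sum_option, hT0, hRd, hQd] at this
    linear_combination this
  have hTs0 : ∀ k, T (some k) none = 0 := fun k => by
    have := congrFun (congrFun hTQ none) (some k)
    simp only [mul_apply, Fintype.sum_option, hT0, hR0, hQd, transpose_apply, hQ0, zero_mul,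
      Finset.sum_const_zero, add_zero, mul_zero, mul_one] at this
    refine (mul_eq_zero.1 this).resolve_left fun h => ?_
    rw [h] at hc
    norm_num at hc
  choose r hr using hg
  have hTs : ∀ i k, k ≠ b i → T (some (g i)) (some k) = 0 := fun i k hk => by
    have := hrow' i k hk.symm
    rw [hT0, mul_zero, zero_add] at this
    exact (mul_eq_zero.1 this).resolve_left (hμ i)
  have hcorr : ∀ i j, R (some (g i)) (some (g j)) = T (some (g i)) (some (b i)) *
      T (some (g j)) (some (b j)) * Q (some (b i)) (some (b j)) := fun i j => by
    rw [← congrFun (congrFun hTQ (some (g i))) (some (g j))]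
    simp only [mul_apply, Fintype.sum_option, hTs0, transpose_apply, zero_mul, mul_zero, zero_add]
    rw [Finset.sum_eq_single (b j) _ (by simp), Finset.sum_eq_single (b i) _ (by simp)]
    · ring
    · intro k _ hk
      rw [hTs i k hk, zero_mul]
    · intro k _ hk
      rw [hTs j k hk, mul_zero]
  -- If one true group were split, its row of `T` would vanish, against its unit variance.
  have hbr : ∀ i, b i = b (r (g i)) := fun i => by
    by_contra hne
    have h1 := hcorr i i
    have h2 := hTs (r (g i)) (b i) hne
    rw [hr] at h2
    rw [h2, hRd] at h1
    norm_num at h1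
  have hd : ∀ k, T (some k) (some (b (r k))) ^ 2 = 1 := fun k => by
    have h1 := hcorr (r k) (r k)
    rw [hr, hRd, hQd] at h1
    linear_combination -h1
  have hcorr' : ∀ k l, R (some k) (some l) = T (some k) (some (b (r k))) *
      T (some l) (some (b (r l))) * Q (some (b (r k))) (some (b (r l))) := fun k l => by
    have := hcorr (r k) (r l)
    rwa [hr, hr] at this
  refine ⟨T none none, fun k => T (some k) (some (b (r k))), fun k => b (r k), hc, hd, ?_, hbr,
    fun i => by rw [hrow0, hTs0]; ring, fun i => ?_, hcorr'⟩
  -- Two group factors sent to the same group would have correlation `1` or `-1`.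
  · intro k l hkl
    by_contra hne
    refine hR.sq_ne_one hRd (show some k ≠ some l from fun h => hne (Option.some.inj h)) ?_
    have hkl' : b (r k) = b (r l) := hkl
    rw [hcorr' k l, ← hkl', hQd, mul_one, mul_pow, hd]
    have := hd l
    rw [← hkl'] at this
    rw [this, one_mul]
  · have := hrow i (b i)
    rw [if_pos rfl, hT0] at this
    have hb : T (some (g i)) (some (b (r (g i)))) = T (some (g i)) (some (b i)) := by rw [← hbr]
    rw [this]
    simp only [hb]
    ring

-- Each variable loads on at most the general factor and one group factor, and these are
-- uncorrelated, so only two terms of the double sum survive.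
open Matrix in
theorem IsBifactor.common_apply {J G : ℕ} {b : Fin J → Fin G} {Λ : Matrix (Fin J) (Fin (G + 1)) ℝ}
    {Φ : Matrix (Fin (G + 1)) (Fin (G + 1)) ℝ} {Ψ : Matrix (Fin J) (Fin J) ℝ}
    (h : IsBifactor b Λ Φ Ψ) (i j : Fin J) :
    (Λ * Φ * Λᵀ) i j = Λ i 0 * Λ j 0 +
      Λ i (b i).succ * Λ j (b j).succ * Φ (b i).succ (b j).succ := by
  have h0 : ∀ k : Fin G, Φ 0 k.succ = 0 := fun k => h.general_uncorrelated _ (Fin.succ_ne_zero k)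
  have h0' : ∀ k : Fin G, Φ k.succ 0 = 0 := fun k => by
    have := h.posDef.isHermitian.apply k.succ 0
    simpa [h0] using this.symm
  have hΛ : ∀ (i : Fin J) (f : Fin G → ℝ),
      ∑ k : Fin G, Λ i k.succ * f k = Λ i (b i).succ * f (b i) := fun i f =>
    Finset.sum_eq_single _ (fun k _ hk => by rw [h.loading_eq_zero i k hk.symm, zero_mul]) (by simp)
  have hΛ' : ∀ (i : Fin J) (f : Fin G → ℝ),
      ∑ k : Fin G, f k * Λ i k.succ = f (b i) * Λ i (b i).succ := fun i f => by
    simp only [mul_comm (f _), hΛ]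
  simp only [mul_apply, transpose_apply, Fin.sum_univ_succ, h0, h0', h.diag_eq_one, mul_zero,
    add_zero, zero_add, mul_one, hΛ, hΛ']
  ring

open Matrix in
/-- On the variables of a set `S` of groups, a bi-factor model whose group loadings do not vanish
is determined by the common part of its covariance matrix. -/
theorem IsBifactor.unique_on {J G : ℕ} {bs b : Fin J → Fin G}
    {Λs Λ : Matrix (Fin J) (Fin (G + 1)) ℝ} {Φs Φ : Matrix (Fin (G + 1)) (Fin (G + 1)) ℝ}
    {Ψs Ψ : Matrix (Fin J) (Fin J) ℝ} (hs : IsBifactor bs Λs Φs Ψs) (h : IsBifactor b Λ Φ Ψ)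
    (hb : Function.Surjective bs) (hμ : ∀ i, Λs i (bs i).succ ≠ 0) (S : Set (Fin G))
    (hL : ∀ i j, bs i ∈ S → bs j ∈ S → (Λs * Φs * Λsᵀ) i j = (Λ * Φ * Λᵀ) i j)
    {g g' : Fin G} (hg : g ∈ S) (hg' : g' ∈ S) (hgg' : g ≠ g')
    {i₁ i₂ i₃ j₁ j₂ : Fin J} (hi₁ : bs i₁ = g) (hi₂ : bs i₂ = g) (hi₃ : bs i₃ = g)
    (hj₁ : bs j₁ = g') (hj₂ : bs j₂ = g')
    (h₁₂ : Λs i₁ 0 * Λs i₂ g.succ ≠ Λs i₂ 0 * Λs i₁ g.succ)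
    (h₁₃ : Λs i₁ 0 * Λs i₃ g.succ ≠ Λs i₃ 0 * Λs i₁ g.succ)
    (h₂₃ : Λs i₂ 0 * Λs i₃ g.succ ≠ Λs i₃ 0 * Λs i₂ g.succ)
    (hj₁₂ : Λs j₁ 0 * Λs j₂ g'.succ ≠ Λs j₂ 0 * Λs j₁ g'.succ) :
    ∃ (c : ℝ) (d : Fin G → ℝ) (p : Fin G → Fin G), c ^ 2 = 1 ∧ (∀ k ∈ S, d k ^ 2 = 1) ∧
      Set.InjOn p S ∧ (∀ i, bs i ∈ S → b i = p (bs i)) ∧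
      (∀ i, bs i ∈ S → Λ i 0 = c * Λs i 0) ∧
      (∀ i, bs i ∈ S → Λ i (b i).succ = d (bs i) * Λs i (bs i).succ) ∧
      ∀ k ∈ S, ∀ l ∈ S, Φs k.succ l.succ = d k * d l * Φ (p k).succ (p l).succ := by
  classical
  have hinj : Function.Injective fun k : Option S => k.elim (0 : Fin (G + 1)) fun k => k.1.succ := by
    rintro (_ | k) (_ | l) hkl
    · rfl
    · exact absurd hkl.symm (Fin.succ_ne_zero _)
    · exact absurd hkl (Fin.succ_ne_zero _)
    · exact congrArg some (Subtype.ext (Fin.succ_injective _ hkl))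
  obtain ⟨c, d, p, hc, hd, hp, hbp, ha, hu, hR⟩ := bifactor_unique
    (g := fun i : {i // bs i ∈ S} => (⟨bs i, i.2⟩ : S)) (b := fun i => b i)
    (α := fun i => Λs i 0) (μ := fun i => Λs i (bs i).succ) (R := Φs.submatrix _ _)
    (a := fun i => Λ i 0) (u := fun i => Λ i (b i).succ)
    (Q := Φ.submatrix (finSuccEquiv G).symm (finSuccEquiv G).symm)
    (by
      rintro ⟨k, hk⟩
      obtain ⟨i, rfl⟩ := hb k
      exact ⟨⟨i, hk⟩, rfl⟩)
    (fun i => hμ i) (hs.posDef.submatrix hinj) (fun k => hs.diag_eq_one _)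
    (fun k => hs.general_uncorrelated _ (Fin.succ_ne_zero _))
    (h.posDef.submatrix (finSuccEquiv G).symm.injective) (fun k => h.diag_eq_one _)
    (fun k => h.general_uncorrelated _ (by simp))
    (fun i j => by
      have := hL i j i.2 j.2
      rw [hs.common_apply, h.common_apply] at this
      simpa using this)
    (i₁ := ⟨i₁, hi₁ ▸ hg⟩) (i₂ := ⟨i₂, hi₂ ▸ hg⟩) (i₃ := ⟨i₃, hi₃ ▸ hg⟩)
    (j₁ := ⟨j₁, hj₁ ▸ hg'⟩) (j₂ := ⟨j₂, hj₂ ▸ hg'⟩)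
    (by simp [hi₁, hi₂]) (by simp [hi₁, hi₃]) (by simp [hj₁, hj₂]) (by simpa [hi₁, hj₁])
    (by simpa [hi₁, hi₂]) (by simpa [hi₁, hi₃]) (by simpa [hi₂, hi₃]) (by simpa [hj₁, hj₂])
  -- The values off `S` are arbitrary: every conclusion about `d` and `p` is restricted to `S`.
  refine ⟨c, fun k => if hk : k ∈ S then d ⟨k, hk⟩ else 1,
    fun k => if hk : k ∈ S then p ⟨k, hk⟩ else k, hc, fun k hk => by simp [hk, hd],
    fun k hk l hl hkl => ?_, fun i hi => ?_, fun i hi => ha ⟨i, hi⟩, fun i hi => ?_,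
    fun k hk l hl => ?_⟩
  · simp only [hk, hl, dif_pos] at hkl
    exact congrArg Subtype.val (hp hkl)
  · simpa only [hi, dif_pos] using hbp ⟨i, hi⟩
  · simpa only [hi, dif_pos] using hu ⟨i, hi⟩
  · simpa [hk, hl] using hR ⟨k, hk⟩ ⟨l, hl⟩

/-! ### Communalities from off-diagonal entries -/

open Matrix in
/-- If two nonsingular sets of rows of the loading matrix are disjoint and avoid the variable `i`,
then the communality of `i` is determined by the other entries of the common part. -/
theorem communality_eq {ι n : Type*} [Fintype n] [DecidableEq n] {A B : Matrix ι n ℝ}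
    {R Q : Matrix n n ℝ} (hR : IsUnit R)
    (hL : ∀ i j, i ≠ j → (A * R * Aᵀ) i j = (B * Q * Bᵀ) i j) {i : ι} {r r' : n → ι}
    (hi : ∀ k, r k ≠ i) (hi' : ∀ k, r' k ≠ i) (hrr' : ∀ k l, r' k ≠ r l)
    (hr : IsUnit (A.submatrix r id)) (hr' : IsUnit (A.submatrix r' id)) :
    (A * R * Aᵀ) i i = (B * Q * Bᵀ) i i := by
  have hsub : A.submatrix r' id * R * (A.submatrix r id)ᵀ =
      B.submatrix r' id * Q * (B.submatrix r id)ᵀ := by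
    ext k l
    exact hL _ _ (hrr' k l)
  have hu : IsUnit (B.submatrix r' id * Q) := by
    have hu' : IsUnit (B.submatrix r' id * Q * (B.submatrix r id)ᵀ) := by
      rw [← hsub]
      exact (hr'.mul hR).mul ((isUnit_transpose _).2 hr)
    rw [isUnit_iff_isUnit_det, det_mul] at hu'
    exact (isUnit_iff_isUnit_det _).2 (isUnit_of_mul_isUnit_left hu')
  -- Row `i` of `A` is the combination `z` of the rows `r`. Covariances with the rows `r'` carry the
  -- same combination over to `B`, so both communalities equal `z` paired with the covariances of
  -- `i` and the rows `r`.
  obtain ⟨z, hz⟩ := mulVec_surjective_iff_isUnit.2 ((isUnit_transpose _).2 hr) (A i)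
  have hcol : ∀ (C : Matrix ι n ℝ) (P : Matrix n n ℝ) (s : n → ι) (j : ι),
      (C.submatrix s id * P) *ᵥ C j = fun k => (C * P * Cᵀ) (s k) j := fun C P s j => rfl
  have hzB : (B.submatrix r id)ᵀ *ᵥ z = B i := by
    refine mulVec_injective_iff_isUnit.2 hu ?_
    change _ *ᵥ _ = _ *ᵥ B i
    rw [mulVec_mulVec, ← hsub, ← mulVec_mulVec, hz, hcol, hcol]
    funext k
    exact hL _ _ (hi' k)
  have hrow : ∀ (C : Matrix ι n ℝ) (P : Matrix n n ℝ), (C.submatrix r id)ᵀ *ᵥ z = C i →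
      (C * P * Cᵀ) i i = z ⬝ᵥ fun k => (C * P * Cᵀ) (r k) i := fun C P hC => by
    rw [← hcol, ← mulVec_mulVec, dotProduct_mulVec, ← mulVec_transpose, hC, dotProduct_mulVec]
    rfl
  rw [hrow A R hz, hrow B Q hzB]
  congr 1
  funext k
  exact hL _ _ (hi k)

open Matrix in
/-- One variable from each group, and one more that is independent of the one from its group,
have linearly independent loadings. -/
theorem IsBifactor.isUnit_submatrix {J G : ℕ} {b : Fin J → Fin G}
    {Λ : Matrix (Fin J) (Fin (G + 1)) ℝ} {Φ : Matrix (Fin (G + 1)) (Fin (G + 1)) ℝ}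
    {Ψ : Matrix (Fin J) (Fin J) ℝ} (h : IsBifactor b Λ Φ Ψ) (hμ : ∀ i, Λ i (b i).succ ≠ 0)
    {r : Fin G → Fin J} (hr : ∀ g, b (r g) = g) {e : Fin J} {g : Fin G} (he : b e = g)
    (hd : Λ e 0 * Λ (r g) g.succ ≠ Λ (r g) 0 * Λ e g.succ) :
    IsUnit (Λ.submatrix (Fin.cons e r : Fin (G + 1) → Fin J) id) := by
  rw [← mulVec_injective_iff_isUnit, ← coe_mulVecLin, ← LinearMap.ker_eq_bot,
    LinearMap.ker_eq_bot']
  intro x hx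
  have hrow : ∀ i, Λ i ⬝ᵥ x = Λ i 0 * x 0 + Λ i (b i).succ * x (b i).succ := fun i => by
    rw [dotProduct, Fin.sum_univ_succ]
    congr 1
    exact Finset.sum_eq_single _ (fun k _ hk => by rw [h.loading_eq_zero i k hk.symm, zero_mul])
      (by simp)
  have hx0 : Λ e ⬝ᵥ x = 0 := congrFun hx 0
  have hxr : ∀ k, Λ (r k) ⬝ᵥ x = 0 := fun k => congrFun hx k.succ
  simp only [hrow, hr, he] at hx0 hxr
  have h0 := (eq_zero_of_det_ne_zero hd hx0 (hxr g)).1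
  funext k
  refine Fin.cases h0 (fun k => ?_) k
  have := hxr k
  rw [h0, mul_zero, zero_add] at this
  refine (mul_eq_zero.1 this).resolve_left ?_
  have := hμ (r k)
  rwa [hr] at this

/-! ### From rank conditions to minors -/

/-- A block of rank two with nonzero group loadings has two independent rows. -/
theorem exists_independent_rows {J G : ℕ} {b : Fin J → Fin G}
    {Λ : Matrix (Fin J) (Fin (G + 1)) ℝ} (hμ : ∀ i, Λ i (b i).succ ≠ 0) {g : Fin G}
    (hg : g ∈ fullRankGroups b Λ) :
    ∃ i j, b i = g ∧ b j = g ∧ Λ i 0 * Λ j g.succ ≠ Λ j 0 * Λ i g.succ := by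
  by_contra! hall
  -- If all minors vanish, the general column is a multiple of the group column and the rank is at
  -- most one.
  obtain ⟨c, hc⟩ : ∃ c : ℝ, ∀ i, b i = g → Λ i 0 = Λ i g.succ * c := by
    by_cases hne : ∃ i, b i = g
    · obtain ⟨i, hi⟩ := hne
      have hi0 : Λ i g.succ ≠ 0 := hi ▸ hμ i
      refine ⟨Λ i 0 / Λ i g.succ, fun j hj => ?_⟩
      field_simp
      linear_combination hall j i hj hi
    · exact ⟨0, fun i hi => absurd ⟨i, hi⟩ hne⟩
  have hblock : groupBlock b Λ g =
      Matrix.vecMulVec (fun i : {j // b j = g} => Λ i g.succ) ![c, 1] := by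
    ext i k
    fin_cases k
    · simp [groupBlock, Matrix.vecMulVec_apply, hc i i.2]
    · simp [groupBlock, Matrix.vecMulVec_apply]
  have hrank : (groupBlock b Λ g).rank = 2 := hg
  have := Matrix.rank_vecMulVec_le (fun i : {j // b j = g} => Λ i g.succ) ![c, 1]
  rw [← hblock, hrank] at this
  omega

/-- Linearly independent rows of a block have a nonzero minor. -/
theorem minor_ne_zero {J G : ℕ} {b : Fin J → Fin G} {Λ : Matrix (Fin J) (Fin (G + 1)) ℝ}
    {g : Fin G} {i j : {j // b j = g}}
    (h : LinearIndependent ℝ ![groupBlock b Λ g i, groupBlock b Λ g j]) :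
    Λ i 0 * Λ j g.succ ≠ Λ j 0 * Λ i g.succ := by
  have h' : LinearIndependent ℝ (Matrix.of ![groupBlock b Λ g i, groupBlock b Λ g j]).row := h
  rw [Matrix.linearIndependent_rows_iff_isUnit, Matrix.isUnit_iff_isUnit_det, Matrix.det_fin_two,
    isUnit_iff_ne_zero] at h'
  intro heq
  apply h'
  simp [groupBlock]
  linear_combination heq

/-! ### Comparing two models -/

theorem IsBifactor.offDiag_eq {J G : ℕ} {bs b : Fin J → Fin G}
    {Λs Λ : Matrix (Fin J) (Fin (G + 1)) ℝ} {Φs Φ : Matrix (Fin (G + 1)) (Fin (G + 1)) ℝ}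
    {Ψs Ψ : Matrix (Fin J) (Fin J) ℝ} (hs : IsBifactor bs Λs Φs Ψs) (h : IsBifactor b Λ Φ Ψ)
    (hcov : Λs * Φs * Λs.transpose + Ψs = Λ * Φ * Λ.transpose + Ψ) {i j : Fin J} (hij : i ≠ j) :
    (Λs * Φs * Λs.transpose) i j = (Λ * Φ * Λ.transpose) i j := by
  have := congrFun (congrFun hcov i) j
  simpa [Matrix.add_apply, hs.isDiag hij, h.isDiag hij] using this

open Matrix in
/-- The parameters differ by a signed permutation of the factors as soon as they do so entrywise. -/
theorem exists_signFlip_permutation {J G : ℕ} {bs b : Fin J → Fin G}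
    {Λs Λ : Matrix (Fin J) (Fin (G + 1)) ℝ} {Φs Φ : Matrix (Fin (G + 1)) (Fin (G + 1)) ℝ}
    {Ψs Ψ : Matrix (Fin J) (Fin J) ℝ} (hs : IsBifactor bs Λs Φs Ψs) (h : IsBifactor b Λ Φ Ψ)
    {c : ℝ} {d : Fin G → ℝ} {p : Fin G → Fin G} (hc : c ^ 2 = 1) (hd : ∀ k, d k ^ 2 = 1)
    (hp : Function.Injective p) (hb : ∀ i, b i = p (bs i)) (ha : ∀ i, Λ i 0 = c * Λs i 0)
    (hu : ∀ i, Λ i (b i).succ = d (bs i) * Λs i (bs i).succ)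
    (hΦ : ∀ k l, Φs k.succ l.succ = d k * d l * Φ (p k).succ (p l).succ) :
    ∃ D ∈ signFlipMatrices (G + 1), ∃ P ∈ factorPermutationMatrices G,
      Λ = Λs * P * D ∧ Φ = D * Pᵀ * Φs * P * D := by
  let q : Equiv.Perm (Fin G) := Equiv.ofBijective p (Finite.injective_iff_bijective.1 hp)
  have hq : ∀ k, q k = p k := fun k => rfl
  let σ : Equiv.Perm (Fin (G + 1)) := Equiv.Perm.decomposeFin.symm (0, q)
  have hσ0 : σ 0 = 0 := by simp [σ]
  have hσs : ∀ k : Fin G, σ k.succ = (p k).succ := fun k => by simp [σ, hq]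
  have hσ0' : σ.symm 0 = 0 := by rw [Equiv.symm_apply_eq, hσ0]
  have hσs' : ∀ k : Fin G, σ.symm k.succ = (q.symm k).succ := fun k => by
    rw [Equiv.symm_apply_eq, hσs, ← hq, Equiv.apply_symm_apply]
  -- Column `k.succ` of `Λ` carries the true group factor `q.symm k`, so it takes that factor's
  -- sign.
  let f : Fin (G + 1) → ℝ := Fin.cons c fun k => d (q.symm k)
  have hPapp : ∀ (N : Matrix (Fin J) (Fin (G + 1)) ℝ) i k,
      (N * σ.permMatrix ℝ) i k = N i (σ.symm k) := fun N i k => by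
    rw [PEquiv.mul_toMatrix_toPEquiv]; rfl
  have h0 : ∀ k : Fin G, Φ 0 k.succ = 0 := fun k => h.general_uncorrelated _ (Fin.succ_ne_zero k)
  have h0' : ∀ k : Fin G, Φ k.succ 0 = 0 := fun k => by
    have := h.posDef.isHermitian.apply k.succ 0
    simpa [h0] using this.symm
  have hs0 : ∀ k : Fin G, Φs 0 k.succ = 0 := fun k =>
    hs.general_uncorrelated _ (Fin.succ_ne_zero k)
  have hs0' : ∀ k : Fin G, Φs k.succ 0 = 0 := fun k => by
    have := hs.posDef.isHermitian.apply k.succ 0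
    simpa [hs0] using this.symm
  refine ⟨diagonal f, ⟨f, fun k => ?_, rfl⟩, σ.permMatrix ℝ, ⟨σ, rfl, ?_⟩, ?_, ?_⟩
  · rw [← mul_self_eq_one_iff, ← sq]
    refine Fin.cases hc (fun k => hd _) k
  · simp [Equiv.toPEquiv_apply, PEquiv.toMatrix_apply, hσ0]
  · ext i k
    rw [mul_diagonal, hPapp]
    refine Fin.cases ?_ (fun k => ?_) k
    · rw [hσ0', ha]
      exact mul_comm _ _
    · rw [hσs']
      change _ = _ * d (q.symm k)
      by_cases hk : b i = k
      · have hk' : bs i = q.symm k := by rw [Equiv.eq_symm_apply, hq, ← hb, hk]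
        rw [← hk', ← hk, hu, mul_comm]
      · rw [h.loading_eq_zero i k hk, hs.loading_eq_zero i, zero_mul]
        intro hk'
        rw [Equiv.eq_symm_apply, hq, ← hb] at hk'
        exact hk hk'
  · have hent : ∀ k l, (diagonal f * (σ.permMatrix ℝ)ᵀ * Φs * σ.permMatrix ℝ * diagonal f) k l =
        f k * Φs (σ.symm k) (σ.symm l) * f l := fun k l => by
      rw [mul_diagonal, Matrix.mul_assoc (diagonal f), Matrix.mul_assoc (diagonal f),
        diagonal_mul, transpose_permMatrix, PEquiv.mul_toMatrix_toPEquiv,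
        PEquiv.toMatrix_toPEquiv_mul]
      rfl
    ext k l
    rw [hent]
    refine Fin.cases ?_ (fun k => ?_) k <;> refine Fin.cases ?_ (fun l => ?_) l
    · rw [hσ0', h.diag_eq_one, hs.diag_eq_one]
      change 1 = c * 1 * c
      linear_combination -hc
    · rw [hσ0', hσs', h0, hs0]; ring
    · rw [hσ0', hσs', h0', hs0']; ring
    · rw [hσs', hσs', hΦ, ← hq, ← hq, Equiv.apply_symm_apply, Equiv.apply_symm_apply]
      change _ = d (q.symm k) * _ * d (q.symm l)
      linear_combination -Φ k.succ l.succ * (d (q.symm l) ^ 2 * hd (q.symm k) + hd (q.symm l))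

/-! ### Large and two-item groups of the extraversion data -/

/-- The groups of the extraversion items with at least three items. -/
def largeGroups : Finset (Fin 7) := {0, 2, 3, 4}

theorem mem_largeGroups {Λ : Matrix (Fin 24) (Fin (7 + 1)) ℝ} {g : Fin 7}
    (hg : 3 ≤ (groupSupport extraversionGroup Λ g).ncard) : g ∈ largeGroups := by
  have hle : (groupSupport extraversionGroup Λ g).ncard ≤
      (Finset.univ.filter fun j => extraversionGroup j = g).card := by
    rw [← Set.ncard_coe_finset]
    exact Set.ncard_le_ncard (fun j hj => by simpa using hj.1)
  have key : ∀ g, 3 ≤ (Finset.univ.filter fun j => extraversionGroup j = g).card →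
      g ∈ largeGroups := by decide
  exact key g (hg.trans hle)

theorem extraversionGroup_surjective : Function.Surjective extraversionGroup := by decide

theorem three_le_card_of_mem_largeGroups : ∀ g ∈ largeGroups,
    3 ≤ (Finset.univ.filter fun j => extraversionGroup j = g).card := by
  decide

theorem two_le_card_group : ∀ g,
    2 ≤ (Finset.univ.filter fun j => extraversionGroup j = g).card := by
  decide

theorem exists_third_of_mem_largeGroups {g : Fin 7} (hg : g ∈ largeGroups) (i j : Fin 24) :
    ∃ k, extraversionGroup k = g ∧ k ≠ i ∧ k ≠ j := by
  obtain ⟨k, hk, hkij⟩ := Finset.exists_mem_notMem_of_card_lt_card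
    (Finset.card_le_two.trans_lt (three_le_card_of_mem_largeGroups g hg) :
      ({i, j} : Finset (Fin 24)).card < _)
  simp only [Finset.mem_insert, Finset.mem_singleton, not_or] at hkij
  exact ⟨k, (Finset.mem_filter.1 hk).2, hkij⟩

/-- A large group can spare `i`, and a two-item group does not contain it. -/
theorem exists_pair_avoiding {i : Fin 24} (hi : extraversionGroup i ∈ largeGroups) (g : Fin 7) :
    ∃ x y, extraversionGroup x = g ∧ extraversionGroup y = g ∧ x ≠ y ∧ x ≠ i ∧ y ≠ i := by
  have hcard : 1 < ((Finset.univ.filter fun j => extraversionGroup j = g).erase i).card := by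
    by_cases h : extraversionGroup i = g
    · have := three_le_card_of_mem_largeGroups g (h ▸ hi)
      have := Finset.pred_card_le_card_erase
        (s := Finset.univ.filter fun j => extraversionGroup j = g) (a := i)
      omega
    · rw [Finset.erase_eq_of_notMem (by simpa using h)]
      exact two_le_card_group g
  obtain ⟨x, hx, y, hy, hxy⟩ := Finset.one_lt_card.1 hcard
  simp only [Finset.mem_erase, Finset.mem_filter, Finset.mem_univ, true_and] at hx hy
  exact ⟨x, y, hx.2, hy.2, hxy, hx.1, hy.1⟩

theorem exists_partner : ∀ i, extraversionGroup i ∉ largeGroups →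
    ∃ j, j ≠ i ∧ extraversionGroup j = extraversionGroup i ∧
      ∀ k, extraversionGroup k = extraversionGroup i → k = i ∨ k = j := by
  decide

theorem card_small_variables :
    (Finset.univ.filter fun i => extraversionGroup i ∉ largeGroups).card = 6 := by
  decide

open Matrix in
/-- Outside two groups that contain independent rows, the communalities of the variables in the
large groups are determined. -/
theorem communality_eq_of_mem_largeGroups {Λs Λ : Matrix (Fin 24) (Fin (7 + 1)) ℝ}
    {Φs Φ : Matrix (Fin (7 + 1)) (Fin (7 + 1)) ℝ} {Ψs : Matrix (Fin 24) (Fin 24) ℝ}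
    (hs : IsBifactor extraversionGroup Λs Φs Ψs)
    (hμ : ∀ i, Λs i (extraversionGroup i).succ ≠ 0)
    (hL : ∀ i j, i ≠ j → (Λs * Φs * Λsᵀ) i j = (Λ * Φ * Λᵀ) i j) {i : Fin 24}
    (hi : extraversionGroup i ∈ largeGroups) {γ γ' : Fin 7} (hγ : γ ∈ largeGroups)
    (hγ' : γ' ∈ largeGroups) (hγγ' : γ ≠ γ') (hiγ : extraversionGroup i ≠ γ)
    (hiγ' : extraversionGroup i ≠ γ') (hfγ : γ ∈ fullRankGroups extraversionGroup Λs)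
    (hfγ' : γ' ∈ fullRankGroups extraversionGroup Λs) :
    (Λs * Φs * Λsᵀ) i i = (Λ * Φ * Λᵀ) i i := by
  obtain ⟨e, e', he, he', hee'⟩ := exists_independent_rows hμ hfγ
  obtain ⟨f, f', hf, hf', hff'⟩ := exists_independent_rows hμ hfγ'
  have hne : e ≠ e' := by rintro rfl; exact hee' rfl
  have hnf : f ≠ f' := by rintro rfl; exact hff' rfl
  -- The extra items are `e` for `r` and `f` for `r'`. In `γ` the three items `e`, `e'` and a third
  -- one are shared out, in `γ'` likewise `f`, `f'` and a third one; every other group gives two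
  -- items different from `i`.
  have hchoice : ∀ g, ∃ x y, extraversionGroup x = g ∧ extraversionGroup y = g ∧ x ≠ y ∧ x ≠ i ∧
      y ≠ i ∧ (g = γ → x = e' ∧ y ≠ e) ∧ (g = γ' → y = f' ∧ x ≠ f) := fun g => by
    by_cases h1 : g = γ
    · subst h1
      obtain ⟨k, hk, hke, hke'⟩ := exists_third_of_mem_largeGroups hγ e e'
      refine ⟨e', k, he', hk, hke'.symm, ?_, ?_, fun _ => ⟨rfl, hke⟩, fun h => absurd h hγγ'⟩
      · rintro rfl; exact hiγ he'
      · rintro rfl; exact hiγ hk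
    by_cases h2 : g = γ'
    · subst h2
      obtain ⟨k, hk, hkf, hkf'⟩ := exists_third_of_mem_largeGroups hγ' f f'
      refine ⟨k, f', hk, hf', hkf', ?_, ?_, fun h => absurd h h1, fun _ => ⟨rfl, hkf⟩⟩
      · rintro rfl; exact hiγ' hk
      · rintro rfl; exact hiγ' hf'
    obtain ⟨x, y, hx, hy, hxy, hxi, hyi⟩ := exists_pair_avoiding hi g
    exact ⟨x, y, hx, hy, hxy, hxi, hyi, fun h => absurd h h1, fun h => absurd h h2⟩
  choose r r' hr hr' hrr' hri hri' hrγ hrγ' using hchoice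
  refine communality_eq hs.posDef.isUnit hL (r := Fin.cons e r) (r' := Fin.cons f r') ?_ ?_ ?_
    (hs.isUnit_submatrix hμ hr he (by rw [(hrγ γ rfl).1]; exact hee'))
    (hs.isUnit_submatrix hμ hr' hf (by rw [(hrγ' γ' rfl).1]; exact hff'))
  · refine Fin.cases ?_ hri
    rintro rfl; exact hiγ he
  · refine Fin.cases ?_ hri'
    rintro rfl; exact hiγ' hf
  · refine Fin.cases (Fin.cases ?_ fun l hl => ?_) fun k => Fin.cases (fun hk => ?_) fun l hl => ?_
    · rintro rfl; exact hγγ' (he.symm.trans hf)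
    · have hl' : f = r l := hl
      have : l = γ' := by rw [← hr l, ← hl', hf]
      exact (hrγ' l this).2 hl'.symm
    · have hk' : r' k = e := hk
      have : k = γ := by rw [← hr' k, hk', he]
      exact (hrγ k this).2 hk'
    · have hl' : r' k = r l := hl
      have : k = l := by rw [← hr' k, hl', hr]
      subst this
      exact hrr' k hl'.symm

/-- Suppose that the variables of the large groups are distributed among the groups of a second
model by an injection `p`, and that each group of that model has two nonzero loadings.  Then each
other variable shares its group there with another variable outside the large groups. -/
theorem exists_groupmate {b : Fin 24 → Fin 7} {Λ : Matrix (Fin 24) (Fin (7 + 1)) ℝ}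
    {p : Fin 7 → Fin 7} (hp : Set.InjOn p largeGroups)
    (hb : ∀ i, extraversionGroup i ∈ largeGroups → b i = p (extraversionGroup i))
    (hsupp : ∀ g, 2 ≤ (groupSupport b Λ g).ncard) {i : Fin 24}
    (hi : extraversionGroup i ∉ largeGroups) :
    ∃ j, j ≠ i ∧ b j = b i ∧ extraversionGroup j ∉ largeGroups := by
  classical
  let K : Finset (Fin 7) := (largeGroups.image p)ᶜ
  have hK : K.card = 3 := by
    rw [Finset.card_compl, Finset.card_image_of_injOn hp]
    rfl
  have hsmall : ∀ j, b j ∈ K → extraversionGroup j ∉ largeGroups := fun j hj hj' => by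
    rw [Finset.mem_compl] at hj
    exact hj (by rw [hb j hj']; exact Finset.mem_image_of_mem p hj')
  let Y : Finset (Fin 24) := Finset.univ.filter fun j => extraversionGroup j ∉ largeGroups
  let F : Finset (Fin 24) := Finset.univ.filter fun j => b j ∈ K ∧ Λ j (b j).succ ≠ 0
  have hFY : F ⊆ Y := fun j hj => by
    simp only [F, Y, Finset.mem_filter, Finset.mem_univ, true_and] at hj ⊢
    exact hsmall j hj.1
  -- The three groups in `K` need six nonzero loadings, and there are just six items outside the
  -- large groups; hence `F = Y`.
  have hcard : Y.card ≤ F.card := by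
    have hY : Y.card = ∑ _k ∈ K, 2 := by
      rw [Finset.sum_const, hK]
      exact card_small_variables
    rw [hY, Finset.card_eq_sum_card_fiberwise (s := F) (f := b) (t := K)
      (fun j hj => (Finset.mem_filter.1 hj).2.1)]
    refine Finset.sum_le_sum fun k hk => (hsupp k).trans ?_
    rw [← Set.ncard_coe_finset]
    refine Set.ncard_le_ncard fun j hj => ?_
    obtain ⟨rfl, hj⟩ := hj
    simp only [F, Finset.coe_filter, Finset.mem_filter, Finset.mem_univ, true_and,
      Set.mem_ofPred_eq]
    exact ⟨⟨hk, hj⟩, trivial⟩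
  have hiF : i ∈ F := by
    rw [Finset.eq_of_subset_of_card_le hFY hcard]
    simpa [Y] using hi
  have hiK := (Finset.mem_filter.1 hiF).2.1
  obtain ⟨j, hj, hji⟩ := Set.exists_ne_of_one_lt_ncard (hsupp (b i)) i
  exact ⟨j, hji, hj.1, hsmall j (by rw [hj.1]; exact hiK)⟩

/-! ### Identification of the two-item groups -/

/-- Four variables from two different groups that have the same products of group loadings and
factor correlations in a second model, where the first and the third of them share a group, give
perfectly correlated group factors. -/
theorem sq_eq_one_of_shared_group {μ₁ μ₂ μ₃ μ₄ u₁ u₂ u₃ u₄ ρ q q' : ℝ}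
    (hμ₁ : μ₁ ≠ 0) (hμ₂ : μ₂ ≠ 0) (hμ₃ : μ₃ ≠ 0) (hμ₄ : μ₄ ≠ 0)
    (h₁₂ : μ₁ * μ₂ = u₁ * u₂ * q) (h₃₄ : μ₃ * μ₄ = u₃ * u₄ * q')
    (h₁₄ : μ₁ * μ₄ * ρ = u₁ * u₄ * q') (h₃₂ : μ₃ * μ₂ * ρ = u₃ * u₂ * q) : ρ ^ 2 = 1 := by
  have h : μ₁ * μ₂ * (μ₃ * μ₄) * (ρ ^ 2 - 1) = 0 := by
    linear_combination μ₃ * μ₂ * ρ * h₁₄ + u₁ * u₄ * q' * h₃₂ - μ₃ * μ₄ * h₁₂ - u₁ * u₂ * q * h₃₄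
  have h0 : μ₁ * μ₂ * (μ₃ * μ₄) ≠ 0 := mul_ne_zero (mul_ne_zero hμ₁ hμ₂) (mul_ne_zero hμ₃ hμ₄)
  exact sub_eq_zero.1 ((mul_eq_zero.1 h).resolve_left h0)

/-- Two loadings in one group are determined up to sign by their product and by nonzero products
with a further loading. -/
theorem sq_eq_sq_of_products {μ₁ μ₂ μ₃ u₁ u₂ u₃ ρ q : ℝ} (hμ₂ : μ₂ ≠ 0)
    (hμ₃ : μ₃ ≠ 0) (hρ : ρ ≠ 0) (h₁₂ : μ₁ * μ₂ = u₁ * u₂) (h₁₃ : μ₁ * μ₃ * ρ = u₁ * u₃ * q)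
    (h₂₃ : μ₂ * μ₃ * ρ = u₂ * u₃ * q) : μ₁ ^ 2 = u₁ ^ 2 := by
  have hcross : μ₁ * u₂ = μ₂ * u₁ := by
    have : μ₃ * ρ * (μ₁ * u₂ - μ₂ * u₁) = 0 := by linear_combination u₂ * h₁₃ - u₁ * h₂₃
    exact sub_eq_zero.1 ((mul_eq_zero.1 this).resolve_left (mul_ne_zero hμ₃ hρ))
  have : μ₂ * (μ₁ ^ 2 - u₁ ^ 2) = 0 := by linear_combination μ₁ * h₁₂ + u₁ * hcross
  exact sub_eq_zero.1 ((mul_eq_zero.1 this).resolve_left hμ₂)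

open Matrix in
theorem theorem2
    (Λs : Matrix (Fin 24) (Fin (7 + 1)) ℝ) (Φs : Matrix (Fin (7 + 1)) (Fin (7 + 1)) ℝ)
    (Ψs : Matrix (Fin 24) (Fin 24) ℝ)
    (hs : IsBifactor extraversionGroup Λs Φs Ψs)
    (hstruct : FollowsExtraversionStructure Λs)
    (hnec : NecessaryCondition extraversionGroup Λs Φs)
    (hsep : SeparationCondition extraversionGroup Λs)
    (b : Fin 24 → Fin 7)
    (Λ : Matrix (Fin 24) (Fin (7 + 1)) ℝ) (Φ : Matrix (Fin (7 + 1)) (Fin (7 + 1)) ℝ)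
    (Ψ : Matrix (Fin 24) (Fin 24) ℝ)
    (h : IsBifactor b Λ Φ Ψ)
    (hnec' : NecessaryCondition b Λ Φ)
    (hcov : Λs * Φs * Λsᵀ + Ψs = Λ * Φ * Λᵀ + Ψ) :
    ∃ D ∈ signFlipMatrices (7 + 1), ∃ P ∈ factorPermutationMatrices 7,
      Λ = Λs * P * D ∧ Φ = D * Pᵀ * Φs * P * D ∧ Ψs = Ψ := by
  have hμ : ∀ i, Λs i (extraversionGroup i).succ ≠ 0 := fun i => (hstruct i _).2 rfl
  have hoff : ∀ i j, i ≠ j → (Λs * Φs * Λsᵀ) i j = (Λ * Φ * Λᵀ) i j :=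
    fun i j hij => hs.offDiag_eq h hcov hij
  obtain ⟨-, g₁, hf₁, g₂, hf₂, g₃, hf₃, h₁₂, h₁₃, h₂₃, hs₁, hs₂, hs₃, hli⟩ := hsep
  have hl₁ := mem_largeGroups hs₁
  have hl₂ := mem_largeGroups hs₂
  have hl₃ := mem_largeGroups hs₃
  have hlarge : ∀ i, extraversionGroup i ∈ largeGroups →
      (Λs * Φs * Λsᵀ) i i = (Λ * Φ * Λᵀ) i i := fun i hi => by
    by_cases e₁ : extraversionGroup i = g₁
    · exact communality_eq_of_mem_largeGroups hs hμ hoff hi hl₂ hl₃ h₂₃ (e₁ ▸ h₁₂) (e₁ ▸ h₁₃)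
        hf₂ hf₃
    by_cases e₂ : extraversionGroup i = g₂
    · exact communality_eq_of_mem_largeGroups hs hμ hoff hi hl₁ hl₃ h₁₃ e₁ (e₂ ▸ h₂₃) hf₁ hf₃
    exact communality_eq_of_mem_largeGroups hs hμ hoff hi hl₁ hl₂ h₁₂ e₁ e₂ hf₁ hf₂
  obtain ⟨i₁, hi₁⟩ := extraversionGroup_surjective g₁
  obtain ⟨i₂, hi₂, h₂₁, -⟩ := exists_third_of_mem_largeGroups hl₁ i₁ i₁
  obtain ⟨i₃, hi₃, h₃₁, h₃₂⟩ := exists_third_of_mem_largeGroups hl₁ i₁ i₂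
  obtain ⟨j₁, j₂, hj₁, hj₂, hj₁₂⟩ := exists_independent_rows hμ hf₂
  have hminor : ∀ i j, extraversionGroup i = g₁ → extraversionGroup j = g₁ → j ≠ i →
      Λs i 0 * Λs j g₁.succ ≠ Λs j 0 * Λs i g₁.succ := fun i j hi hj hij =>
    minor_ne_zero (hli ⟨i, hi⟩ ⟨j, hj⟩ fun he => hij (congrArg Subtype.val he).symm)
  have hunique := fun (S : Set (Fin 7)) hS hg hg' => hs.unique_on h extraversionGroup_surjective hμ
    S hS (g := g₁) (g' := g₂) hg hg' h₁₂ hi₁ hi₂ hi₃ hj₁ hj₂ (hminor i₁ i₂ hi₁ hi₂ h₂₁)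
    (hminor i₁ i₃ hi₁ hi₃ h₃₁) (hminor i₂ i₃ hi₂ hi₃ h₃₂) hj₁₂
  have hdiag : ∀ i, (Λs * Φs * Λsᵀ) i i = (Λ * Φ * Λᵀ) i i := by
    obtain ⟨c, d, p, hc, -, hp, hbp, ha, hu, -⟩ := hunique largeGroups (fun i j hi hj => by
      by_cases hij : i = j
      · subst hij; exact hlarge i hi
      · exact hoff i j hij) hl₁ hl₂
    have ha' : ∀ i, Λ i 0 = c * Λs i 0 := fun i => by
      by_cases hi : extraversionGroup i ∈ largeGroups
      · exact ha i hi
      -- The covariance of `i` with an item of `g₁` is a linear equation in two discrepancies, of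
      -- general loadings and of group parts; two independent items make both vanish.
      have hrow : ∀ j, extraversionGroup j = g₁ → Λs j 0 * (Λs i 0 - c * Λ i 0) +
          Λs j g₁.succ * (Λs i (extraversionGroup i).succ * Φs (extraversionGroup i).succ g₁.succ -
            d g₁ * Λ i (b i).succ * Φ (b i).succ (p g₁).succ) = 0 := fun j hj => by
        have hjl : extraversionGroup j ∈ largeGroups := by rw [hj]; exact hl₁
        have hij : i ≠ j := by rintro rfl; exact hi hjl
        have := hoff i j hij
        rw [hs.common_apply, h.common_apply, ha j hjl, hu j hjl, hbp j hjl, hj] at this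
        linear_combination this
      have h0 := (eq_zero_of_det_ne_zero (hminor i₁ i₂ hi₁ hi₂ h₂₁) (hrow i₁ hi₁)
        (hrow i₂ hi₂)).1
      linear_combination -c * h0 - Λ i 0 * hc
    -- Naming the group loadings keeps later rewriting of group labels from changing them.
    obtain ⟨μ, hμdef⟩ : ∃ μ : Fin 24 → ℝ, ∀ i, Λs i (extraversionGroup i).succ = μ i :=
      ⟨_, fun _ => rfl⟩
    obtain ⟨u, hudef⟩ : ∃ u : Fin 24 → ℝ, ∀ i, Λ i (b i).succ = u i := ⟨_, fun _ => rfl⟩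
    have hμ0 : ∀ i, μ i ≠ 0 := fun i => hμdef i ▸ hμ i
    have hprod : ∀ i j, i ≠ j →
        μ i * μ j * Φs (extraversionGroup i).succ (extraversionGroup j).succ =
        u i * u j * Φ (b i).succ (b j).succ := fun i j hij => by
      have := hoff i j hij
      rw [hs.common_apply, h.common_apply, ha', ha' j, hμdef, hμdef, hudef, hudef] at this
      linear_combination this + Λs i 0 * Λs j 0 * hc
    intro i
    by_cases hi : extraversionGroup i ∈ largeGroups
    · exact hlarge i hi
    obtain ⟨j, hji, hj, honly⟩ := exists_partner i hi
    have hij := hprod i j hji.symm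
    rw [hj, hs.diag_eq_one, mul_one] at hij
    -- Otherwise the mate `k` of `i` has its own partner `l`, and the products among the pairs `i,
    -- j` and `k, l` force a correlation of square `1`.
    have hbj : b j = b i := by
      obtain ⟨k, hki, hbk, hk⟩ := exists_groupmate hp hbp hnec'.two_le_support hi
      by_cases hg : extraversionGroup k = extraversionGroup i
      · rwa [(honly k hg).resolve_left hki] at hbk
      exfalso
      obtain ⟨l, hlk, hl, -⟩ := exists_partner k hk
      have hkl := hprod k l hlk.symm
      have hil := hprod i l (by rintro rfl; exact hg hl.symm)
      have hjk := hprod j k (by rintro rfl; exact hg hj)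
      have hsym : Φ (b j).succ (b i).succ = Φ (b i).succ (b j).succ :=
        h.posDef.isHermitian.apply _ _
      rw [hl, hs.diag_eq_one, mul_one, hbk] at hkl
      rw [hl] at hil
      rw [hj, hbk, hsym] at hjk
      refine hs.posDef.sq_ne_one hs.diag_eq_one
        (fun he => hg (Fin.succ_injective _ he).symm) (sq_eq_one_of_shared_group (hμ0 i) (hμ0 j)
          (hμ0 k) (hμ0 l) hij hkl hil ?_)
      linear_combination hjk
    rw [hbj, h.diag_eq_one, mul_one] at hij
    -- A group uncorrelated with all others would need three nonzero loadings, but this one has two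
    -- items.
    obtain ⟨g, hg, hcorr⟩ : ∃ g, g ≠ extraversionGroup i ∧
        Φs (extraversionGroup i).succ g.succ ≠ 0 := by
      by_contra! hall
      exact hi (mem_largeGroups (hnec.three_le_support _ hall))
    obtain ⟨k, rfl⟩ := extraversionGroup_surjective g
    have hjk := hprod j k (by rintro rfl; exact hg hj)
    rw [hj, hbj] at hjk
    have hsq : μ i ^ 2 = u i ^ 2 := sq_eq_sq_of_products (hμ0 j) (hμ0 k) hcorr hij
      (hprod i k (by rintro rfl; exact hg rfl)) hjk
    rw [hs.common_apply, h.common_apply, ha', hs.diag_eq_one, h.diag_eq_one, hμdef, hudef]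
    linear_combination hsq - Λs i 0 ^ 2 * hc
  have hall : ∀ i j, (Λs * Φs * Λsᵀ) i j = (Λ * Φ * Λᵀ) i j := fun i j => by
    by_cases hij : i = j
    · subst hij; exact hdiag i
    · exact hoff i j hij
  obtain ⟨c, d, p, hc, hd, hp, hbp, ha, hu, hR⟩ := hunique Set.univ (fun i j _ _ => hall i j)
    trivial trivial
  obtain ⟨D, hD, P, hP, h1, h2⟩ := exists_signFlip_permutation hs h hc (fun k => hd k trivial)
    (fun k l hkl => hp trivial trivial hkl) (fun i => hbp i trivial) (fun i => ha i trivial)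
    (fun i => hu i trivial) (fun k l => hR k trivial l trivial)
  refine ⟨D, hD, P, hP, h1, h2, ?_⟩
  have hL : Λs * Φs * Λsᵀ = Λ * Φ * Λᵀ := by
    ext i j
    exact hall i j
  rw [hL] at hcov
  exact add_left_cancel hcov
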